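/- Let $n$ sporadic tasks be given, where task $i\in\{1,\dots,n\}$ has an integer execution time $c_i\ge 1$, an integer period $p_i\ge 1$ and an integer release jitter $J_i$ with $0\le J_i\le p_i$. Put $p_{\max}=\max_{1\le i\le n}p_i$. Let $I\subseteq\{1,\dots,n\}$ be a set of tasks with $\sum_{i\in I}c_i/p_i<1$ and harmonic periods (that is, $p_i\ge p_j$ implies $p_i/p_j\in\mathbb{Z}$ for all $i,j\in I$), and let $\gamma\ge 1$ be an integer. Let $$R(I,\gamma)=\min\Big\{t\in\mathbb{Z}_{\ge 0} \;:\; t\ge\gamma+\sum_{i\in I}c_i\Big\lceil\frac{t+J_i}{p_i}\Big\rceil\Big\}$$ be the generalized response time. Theorem. There is a single algorithm which, given $\gamma$, $|I|$ and the list of triples $(c_i,p_i,J_i)_{i\in I}$, computes $R(I,\gamma)$ with $$O\big(q\cdot|I|^2+|I|^2\log_2 p_{\max}+1\big)$$ operations, where $q=|\{p_i-J_i : i\in I\}|$ and the constant is absolute. In particular, the minimum $R(I,\gamma)$ exists. Here the algorithm is a program with integer variables and integer arrays, composed of assignments, conditionals and while loops; each constant, each read or write of a variable or array cell, each addition, subtraction,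 multiplication and integer division, each comparison and logical connective, and each execution of a statement other than sequential composition is counted as one operation. -/

import Mathlib

open scoped BigOperators

namespace RTC

/-! ### Sporadic tasks and generalized response times -/

/-- `n` sporadic tasks with period-constrained release jitters: task `i` has execution time `c i`,
period `p i` and release jitter `J i`. Deadlines play no role for response times. -/
structure TaskSystem (n : ℕ) where
  c : Fin n → ℕ
  p : Fin n → ℕ
  J : Fin n → ℕ
  one_le_c : ∀ i, 1 ≤ c i
  one_le_p : ∀ i, 1 ≤ p i
  J_le_p : ∀ i, J i ≤ p i

namespace TaskSystem

variable {n : ℕ}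

/-- The periods of the tasks in `I` are harmonic: `p i ≥ p j` implies `p i / p j ∈ ℤ`. -/
def Harmonic (S : TaskSystem n) (I : Finset (Fin n)) : Prop :=
  ∀ i ∈ I, ∀ j ∈ I, S.p j ≤ S.p i → S.p j ∣ S.p i

/-- The utilization of the tasks in `I`. -/
def utilization (S : TaskSystem n) (I : Finset (Fin n)) : ℚ :=
  ∑ i ∈ I, (S.c i : ℚ) / (S.p i : ℚ)

/-- `t` is the generalized response time of `I` and `γ`, that is, the least integer `t ≥ 0` with
`t ≥ γ + ∑ i ∈ I, c i * ⌈(t + J i) / p i⌉`. -/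
def IsResponse (S : TaskSystem n) (I : Finset (Fin n)) (γ t : ℤ) : Prop :=
  IsLeast {t : ℤ | 0 ≤ t ∧
    γ + ∑ i ∈ I, (S.c i : ℤ) * ⌈((t : ℚ) + (S.J i : ℚ)) / (S.p i : ℚ)⌉ ≤ t} t

/-- The number of distinct differences `p i - J i` with `i ∈ I`. -/
def numDiff (S : TaskSystem n) (I : Finset (Fin n)) : ℕ :=
  (I.image fun i => (S.p i : ℤ) - (S.J i : ℤ)).card

/-- The largest period of the task system. -/
def pmax (S : TaskSystem n) : ℕ :=
  Finset.univ.sup S.p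

end TaskSystem

/-! ### Imperative programs over the integers with unit-cost operations

The machine has integer variables `0, 1, 2, …` and integer arrays `0, 1, 2, …`; a program is a
finite piece of syntax, so that it names only finitely many of them, and array cells are addressed
by computed indices. -/

/-- The memory of the machine. -/
@[ext]
structure State where
  var : ℕ → ℤ
  arr : ℕ → ℤ → ℤ

/-- Store the value `v` in variable `x`. -/
def State.setVar (σ : State) (x : ℕ) (v : ℤ) : State :=
  { σ with var := Function.update σ.var x v }

/-- Store the value `v` in cell `k` of array `a`. -/
def State.setArr (σ : State) (a : ℕ) (k v : ℤ) : State :=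
  { σ with arr := Function.update σ.arr a (Function.update (σ.arr a) k v) }

/-- Integer expressions. -/
inductive Expr where
  | const (z : ℤ)
  | var (x : ℕ)
  | read (a : ℕ) (k : Expr)
  | add (e f : Expr)
  | sub (e f : Expr)
  | mul (e f : Expr)
  | div (e f : Expr)

/-- The value of an expression; `div` is integer division, which rounds down for a positive
divisor. -/
def Expr.eval (σ : State) : Expr → ℤ
  | .const z => z
  | .var x => σ.var x
  | .read a k => σ.arr a (k.eval σ)
  | .add e f => e.eval σ + f.eval σ
  | .sub e f => e.eval σ - f.eval σ
  | .mul e f => e.eval σ * f.eval σ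
  | .div e f => e.eval σ / f.eval σ

/-- Every constant, memory access and arithmetic operation in an expression costs one step. -/
def Expr.cost : Expr → ℕ
  | .const _ => 1
  | .var _ => 1
  | .read _ k => k.cost + 1
  | .add e f => e.cost + f.cost + 1
  | .sub e f => e.cost + f.cost + 1
  | .mul e f => e.cost + f.cost + 1
  | .div e f => e.cost + f.cost + 1

/-- Tests. -/
inductive Cond where
  | le (e f : Expr)
  | eq (e f : Expr)
  | not (b : Cond)
  | and (b b' : Cond)

/-- The truth of a test. -/
def Cond.Holds (σ : State) : Cond → Prop
  | .le e f => e.eval σ ≤ f.eval σ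
  | .eq e f => e.eval σ = f.eval σ
  | .not b => ¬ b.Holds σ
  | .and b b' => b.Holds σ ∧ b'.Holds σ

/-- Every comparison and every connective costs one step on top of its arguments. -/
def Cond.cost : Cond → ℕ
  | .le e f => e.cost + f.cost + 1
  | .eq e f => e.cost + f.cost + 1
  | .not b => b.cost + 1
  | .and b b' => b.cost + b'.cost + 1

/-- Programs. -/
inductive Prog where
  | skip
  | assign (x : ℕ) (e : Expr)
  | write (a : ℕ) (k e : Expr)
  | seq (s t : Prog)
  | ite (b : Cond) (s t : Prog)
  | while (b : Cond) (s : Prog)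

/-- `Exec s σ σ' T`: started in the state `σ`, the program `s` halts in the state `σ'` after
exactly `T` steps. -/
inductive Exec : Prog → State → State → ℕ → Prop where
  | skip (σ : State) : Exec .skip σ σ 1
  | assign (x : ℕ) (e : Expr) (σ : State) :
      Exec (.assign x e) σ (σ.setVar x (e.eval σ)) (e.cost + 1)
  | write (a : ℕ) (k e : Expr) (σ : State) :
      Exec (.write a k e) σ (σ.setArr a (k.eval σ) (e.eval σ)) (k.cost + e.cost + 1)
  | seq {s t : Prog} {σ σ₁ σ₂ : State} {T T' : ℕ} :
      Exec s σ σ₁ T → Exec t σ₁ σ₂ T' → Exec (.seq s t) σ σ₂ (T + T')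
  | ite_true {b : Cond} {s t : Prog} {σ σ₁ : State} {T : ℕ} :
      b.Holds σ → Exec s σ σ₁ T → Exec (.ite b s t) σ σ₁ (b.cost + 1 + T)
  | ite_false {b : Cond} {s t : Prog} {σ σ₁ : State} {T : ℕ} :
      ¬ b.Holds σ → Exec t σ σ₁ T → Exec (.ite b s t) σ σ₁ (b.cost + 1 + T)
  | while_true {b : Cond} {s : Prog} {σ σ₁ σ₂ : State} {T T' : ℕ} :
      b.Holds σ → Exec s σ σ₁ T → Exec (.while b s) σ₁ σ₂ T' →
      Exec (.while b s) σ σ₂ (b.cost + 1 + T + T')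
  | while_false {b : Cond} {s : Prog} {σ : State} :
      ¬ b.Holds σ → Exec (.while b s) σ σ (b.cost + 1)

/-- The final state and the number of steps are determined by the program and the initial
state. -/
theorem Exec.deterministic {s : Prog} {σ σ₁ : State} {T₁ : ℕ} (h : Exec s σ σ₁ T₁) :
    ∀ {σ₂ : State} {T₂ : ℕ}, Exec s σ σ₂ T₂ → σ₁ = σ₂ ∧ T₁ = T₂ := by
  induction h with
  | skip σ => intro _ _ h'; cases h'; exact ⟨rfl, rfl⟩
  | assign x e σ => intro _ _ h'; cases h'; exact ⟨rfl, rfl⟩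
  | write a k e σ => intro _ _ h'; cases h'; exact ⟨rfl, rfl⟩
  | seq _ _ ih ih' =>
    intro _ _ h'
    cases h' with
    | seq h₁ h₂ =>
      obtain ⟨rfl, rfl⟩ := ih h₁
      obtain ⟨rfl, rfl⟩ := ih' h₂
      exact ⟨rfl, rfl⟩
  | ite_true hb _ ih =>
    intro _ _ h'
    cases h' with
    | ite_true _ h₁ => obtain ⟨rfl, rfl⟩ := ih h₁; exact ⟨rfl, rfl⟩
    | ite_false hb' _ => exact absurd hb hb'
  | ite_false hb _ ih =>
    intro _ _ h'
    cases h' with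
    | ite_true hb' _ => exact absurd hb' hb
    | ite_false _ h₁ => obtain ⟨rfl, rfl⟩ := ih h₁; exact ⟨rfl, rfl⟩
  | while_true hb _ _ ih ih' =>
    intro _ _ h'
    cases h' with
    | while_true _ h₁ h₂ =>
      obtain ⟨rfl, rfl⟩ := ih h₁
      obtain ⟨rfl, rfl⟩ := ih' h₂
      exact ⟨rfl, rfl⟩
    | while_false hb' => exact absurd hb hb'
  | while_false hb =>
    intro _ _ h'
    cases h' with
    | while_true hb' _ _ => exact absurd hb' hb
    | while_false _ => exact ⟨rfl, rfl⟩

/-! ### Input and output conventions -/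

/-- The array that holds the values `f i`, `i ∈ I`, in its cells `0, …, |I| - 1`, in the order of
the indices, and `0` in all other cells. -/
def listing {n : ℕ} (I : Finset (Fin n)) (f : Fin n → ℕ) (k : ℤ) : ℤ :=
  if h : 0 ≤ k ∧ k.toNat < I.card then (f (I.orderEmbOfFin rfl ⟨k.toNat, h.2⟩) : ℤ) else 0

/-- The initial memory for the instance `(I, γ)`: variable `0` holds `|I|`, variable `1` holds `γ`,
the arrays `0`, `1`, `2` hold the execution times, the periods and the jitters of the tasks in `I`,
and everything else is `0`. -/
def input {n : ℕ} (S : TaskSystem n) (I : Finset (Fin n)) (γ : ℤ) : State where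
  var
    | 0 => I.card
    | 1 => γ
    | _ => 0
  arr
    | 0 => listing I S.c
    | 1 => listing I S.p
    | 2 => listing I S.J
    | _ => fun _ => 0

/-- The result of a computation is the final value of variable `2`. -/
def State.output (σ : State) : ℤ :=
  σ.var 2

end RTC

/-!
The response time is computed with `O(|I| ^ 2)` operations, which the first term of the bound
dominates: `q ≥ 1` unless `I` is empty.

Let the tasks be sorted by period, `p 0 ∣ p 1 ∣ …`, and let `excess k t` be the demand of the first
`k` tasks at time `t`, minus `t`. The response time for `γ` is the least `t` with
`γ + excess m t ≤ 0`. If `q` is a common multiple of the first `k` periods, moving `t` forward by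
`q` lowers the excess by `slack k q`, the capacity that these tasks leave in a window of length `q`
(`excess_add_mul`); it is positive because the utilization is below one. The same holds for the
minimum of the excess over all `r ≤ y` (`IsMinExcess.add_mul`).

These minima satisfy a recurrence with two alternatives (`IsMinExcess.succ`). Let `a` be the number
of jobs of task `k` counted at `y`. A minimizer for `k + 1` tasks counts either `a` of them, or,
after a shift by a multiple of `p k`, exactly `a - 1`, and is then at most `(a - 1) * p k - J k`.
This point is congruent to `-J k` modulo all periods involved, so it is enough to tabulate the minima for
`y = -J j`, and every table entry is updated in constant time for every task.

With the table, the response time comes from eliminating the tasks in the order of decreasing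
periods (`isLeast_response_succ`): by periodicity, one division gives the number `a` of jobs of the
last task `k` that are counted at the response time, and the response time of `k + 1` tasks for `g`
is that of `k` tasks for `g + c k * a`. Without tasks, it is `g` itself.

The program sorts by exchanges, fills the table and eliminates. Its run is analysed with a total
correctness predicate `Runs` that carries a step bound.
-/

namespace RTC

/-! ### Rounding up -/

/-- `⌈x / p⌉`, written with the rounded-down division of the machine. -/
def cdiv (x p : ℤ) : ℤ := -(-x / p)

theorem cdiv_le_iff {p : ℤ} (hp : 0 < p) (x a : ℤ) : cdiv x p ≤ a ↔ x ≤ a * p := by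
  rw [cdiv, neg_le, Int.le_ediv_iff_mul_le hp, neg_mul, neg_le_neg_iff]

theorem cdiv_eq_ceil {p : ℤ} (hp : 0 < p) (x : ℤ) : cdiv x p = ⌈(x : ℚ) / (p : ℚ)⌉ := by
  refine eq_of_forall_ge_iff fun a => ?_
  have hp' : (0 : ℚ) < p := by exact_mod_cast hp
  rw [cdiv_le_iff hp, Int.ceil_le, div_le_iff₀ hp']
  exact_mod_cast Iff.rfl

theorem le_cdiv_mul {p : ℤ} (hp : 0 < p) (x : ℤ) : x ≤ cdiv x p * p :=
  (cdiv_le_iff hp x _).1 le_rfl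

theorem cdiv_mono {p : ℤ} (hp : 0 < p) {x y : ℤ} (h : x ≤ y) : cdiv x p ≤ cdiv y p :=
  (cdiv_le_iff hp _ _).2 (h.trans (le_cdiv_mul hp y))

theorem cdiv_add_mul {p : ℤ} (hp : 0 < p) (x z : ℤ) : cdiv (x + z * p) p = cdiv x p + z := by
  refine eq_of_forall_ge_iff fun a => ?_
  rw [cdiv_le_iff hp, ← le_sub_iff_add_le (c := a), cdiv_le_iff hp, sub_mul, le_sub_iff_add_le]

/-! ### Minima of the excess demand -/

section Demand

variable (c p J : ℕ → ℤ)

/-- The demand of the tasks `0, …, k - 1` at time `t`, minus `t`. -/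
def excess (k : ℕ) (t : ℤ) : ℤ :=
  ∑ i ∈ Finset.range k, c i * cdiv (t + J i) (p i) - t

/-- If all periods `p i`, `i < k`, divide `z`, this is the capacity `z * (1 - ∑ c i / p i)` that
the tasks `0, …, k - 1` leave in a window of length `z`. -/
def slack (k : ℕ) (z : ℤ) : ℤ :=
  z - ∑ i ∈ Finset.range k, c i * (z / p i)

/-- `v` is the minimum of the excess demand of the tasks `0, …, k - 1` over all integers `r ≤ y`,
negative ones included. -/
def IsMinExcess (k : ℕ) (y v : ℤ) : Prop :=
  ∀ b, (∃ r ≤ y, excess c p J k r ≤ b) ↔ v ≤ b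

variable {c p J}

theorem excess_succ (k : ℕ) (t : ℤ) :
    excess c p J (k + 1) t = excess c p J k t + c k * cdiv (t + J k) (p k) := by
  simp only [excess, Finset.sum_range_succ]; ring

theorem slack_succ (k : ℕ) (z : ℤ) :
    slack c p (k + 1) z = slack c p k z - c k * (z / p k) := by
  simp only [slack, Finset.sum_range_succ]; ring

theorem slack_mul {k : ℕ} {q : ℤ} (hq : ∀ i < k, p i ∣ q) (z : ℤ) :
    slack c p k (z * q) = z * slack c p k q := by
  rw [slack, slack, mul_sub, Finset.mul_sum]
  congr 1
  refine Finset.sum_congr rfl fun i hi => ?_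
  rw [Int.mul_ediv_assoc _ (hq i (Finset.mem_range.1 hi))]; ring

theorem slack_pos {k : ℕ} {z : ℤ} (hz : 0 < z) (hp : ∀ i < k, p i ∣ z)
    (hU : ∑ i ∈ Finset.range k, (c i : ℚ) / (p i : ℚ) < 1) : 0 < slack c p k z := by
  have hz' : (0 : ℚ) < z := by exact_mod_cast hz
  have h : ((slack c p k z : ℤ) : ℚ)
      = z * (1 - ∑ i ∈ Finset.range k, (c i : ℚ) / (p i : ℚ)) := by
    rw [slack, Int.cast_sub, Int.cast_sum, mul_sub, mul_one, Finset.mul_sum]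
    congr 1
    refine Finset.sum_congr rfl fun i hi => ?_
    have hd := hp i (Finset.mem_range.1 hi)
    have h0 : (p i : ℚ) ≠ 0 := by
      intro h0
      have : p i = 0 := by exact_mod_cast h0
      rw [this, zero_dvd_iff] at hd
      exact hz.ne' hd
    rw [Int.cast_mul, Int.cast_div hd h0]; ring
  have : (0 : ℚ) < (slack c p k z : ℤ) := by
    rw [h]; exact mul_pos hz' (by linarith)
  exact_mod_cast this

theorem excess_add_mul {k : ℕ} {q : ℤ} (hp : ∀ i < k, 0 < p i) (hq : ∀ i < k, p i ∣ q)
    (t z : ℤ) : excess c p J k (t + z * q) = excess c p J k t - z * slack c p k q := by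
  rw [← slack_mul hq, excess, excess, slack]
  have : ∑ i ∈ Finset.range k, c i * cdiv (t + z * q + J i) (p i)
      = ∑ i ∈ Finset.range k, c i * cdiv (t + J i) (p i)
        + ∑ i ∈ Finset.range k, c i * (z * q / p i) := by
    rw [← Finset.sum_add_distrib]
    refine Finset.sum_congr rfl fun i hi => ?_
    have hi := Finset.mem_range.1 hi
    obtain ⟨w, hw⟩ := (hq i hi).mul_left z
    have h1 : t + z * q + J i = t + J i + w * p i := by rw [hw]; ring
    rw [h1, cdiv_add_mul (hp i hi), hw, Int.mul_ediv_cancel_left _ (hp i hi).ne']; ring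
  rw [this]; ring

theorem isMinExcess_zero (y : ℤ) : IsMinExcess c p J 0 y (-y) := by
  intro b
  simp only [excess, Finset.range_zero, Finset.sum_empty, zero_sub]
  exact ⟨fun ⟨r, hr, h⟩ => by linarith, fun h => ⟨y, le_rfl, h⟩⟩

theorem IsMinExcess.add_mul {k : ℕ} {q y v : ℤ} (hp : ∀ i < k, 0 < p i)
    (hq : ∀ i < k, p i ∣ q) (h : IsMinExcess c p J k y v) (z : ℤ) :
    IsMinExcess c p J k (y + z * q) (v - z * slack c p k q) := by
  intro b
  rw [sub_le_iff_le_add, ← h]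
  constructor
  · rintro ⟨r, hr, hb⟩
    refine ⟨r + -z * q, by linarith, ?_⟩
    rw [excess_add_mul hp hq]; linarith
  · rintro ⟨r, hr, hb⟩
    refine ⟨r + z * q, by linarith, ?_⟩
    rw [excess_add_mul hp hq]; linarith

/-- Adding the task `k` of longest period. Let `a` be the number of its jobs up to `y`. A minimizer
either sees `a` jobs of task `k`, or it can be shifted by multiples of the period, which does not
increase the excess, until it sees exactly `a - 1` of them; the last such point is
`(a - 1) * p k - J k`. -/
theorem IsMinExcess.succ {k : ℕ} {y u v a : ℤ} (hp : ∀ i ≤ k, 0 < p i) (hc : 0 ≤ c k)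
    (hd : ∀ i ≤ k, p i ∣ p k) (hs : 0 ≤ slack c p (k + 1) (p k)) (ha : a = cdiv (y + J k) (p k))
    (hu : IsMinExcess c p J k y u) (hv : IsMinExcess c p J k ((a - 1) * p k - J k) v) :
    IsMinExcess c p J (k + 1) y (min (c k * a + u) (c k * (a - 1) + v)) := by
  have hpk := hp k le_rfl
  have hya : (a - 1) * p k - J k ≤ y := by
    by_contra hlt
    have : cdiv (y + J k) (p k) ≤ a - 1 := (cdiv_le_iff hpk _ _).2 (by linarith)
    omega
  intro b
  have e1 : min (c k * a + u) (c k * (a - 1) + v) ≤ b ↔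
      u ≤ b - c k * a ∨ v ≤ b - c k * (a - 1) := by
    rw [min_le_iff]
    constructor <;> rintro (h | h) <;> [left; right; left; right] <;> linarith
  rw [e1, ← hu, ← hv]
  constructor
  · rintro ⟨r, hr, hb⟩
    have hle : cdiv (r + J k) (p k) ≤ a := ha ▸ cdiv_mono hpk (by linarith)
    rcases hle.eq_or_lt with h | h
    · left
      refine ⟨r, hr, ?_⟩
      rw [excess_succ, h] at hb
      linarith
    · right
      set s := a - 1 - cdiv (r + J k) (p k) with hsdef
      have hs0 : 0 ≤ s := by omega
      have hceil : cdiv (r + s * p k + J k) (p k) = a - 1 := by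
        rw [show r + s * p k + J k = r + J k + s * p k by ring, cdiv_add_mul hpk]; omega
      refine ⟨r + s * p k, ?_, ?_⟩
      · have := (cdiv_le_iff hpk (r + s * p k + J k) (a - 1)).1 hceil.le
        linarith
      · have h1 := excess_add_mul (c := c) (J := J) (k := k + 1) (q := p k)
          (fun i hi => hp i (by omega)) (fun i hi => hd i (by omega)) r s
        rw [excess_succ, hceil] at h1
        have := mul_nonneg hs0 hs
        linarith
  · rintro (⟨r, hr, hb⟩ | ⟨r, hr, hb⟩)
    · refine ⟨r, hr, ?_⟩
      have h1 : cdiv (r + J k) (p k) ≤ a := ha ▸ cdiv_mono hpk (by linarith)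
      have := mul_le_mul_of_nonneg_left h1 hc
      rw [excess_succ]; linarith
    · refine ⟨r, hr.trans hya, ?_⟩
      have h1 : cdiv (r + J k) (p k) ≤ a - 1 := (cdiv_le_iff hpk _ _).2 (by linarith)
      have := mul_le_mul_of_nonneg_left h1 hc
      rw [excess_succ]; linarith

/-- The recurrence when the minima at the points `-J i` are tabulated: the breakpoint
`(a - 1) * p k - J k` is congruent to `-J k` modulo all periods involved. -/
theorem IsMinExcess.succ_of_table {k : ℕ} {y u w a : ℤ} (hp : ∀ i ≤ k, 0 < p i) (hc : 0 ≤ c k)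
    (hd : ∀ i ≤ k, p i ∣ p k) (hs : 0 ≤ slack c p (k + 1) (p k)) (ha : a = cdiv (y + J k) (p k))
    (hu : IsMinExcess c p J k y u) (hw : IsMinExcess c p J k (-J k) w) :
    IsMinExcess c p J (k + 1) y
      (min (c k * a + u) (c k * (a - 1) + (w - (a - 1) * slack c p k (p k)))) := by
  refine IsMinExcess.succ hp hc hd hs ha hu ?_
  have := hw.add_mul (q := p k) (fun i hi => hp i hi.le) (fun i hi => hd i hi.le) (a - 1)
  rwa [neg_add_eq_sub] at this

/-- At its own breakpoint `-J k` the task `k` does not change the minimum. -/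
theorem IsMinExcess.succ_self {k : ℕ} {w : ℤ} (hp : ∀ i ≤ k, 0 < p i) (hc : 0 ≤ c k)
    (hd : ∀ i ≤ k, p i ∣ p k) (hs : 0 ≤ slack c p (k + 1) (p k))
    (hw : IsMinExcess c p J k (-J k) w) : IsMinExcess c p J (k + 1) (-J k) w := by
  -- The first alternative is `w`, and the second exceeds it by `slack c p (k + 1) (p k)`.
  have h := IsMinExcess.succ_of_table hp hc hd hs (a := 0) (by simp [cdiv]) hw hw
  rw [slack_succ, Int.ediv_self (hp k le_rfl).ne'] at hs
  rwa [min_eq_left (by linarith), mul_zero, zero_add] at h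

/-! ### Response times -/

theorem isLeast_response_zero (g : ℤ) : IsLeast {t | g + excess c p J 0 t ≤ 0} g := by
  constructor
  · simp [excess]
  · intro t ht
    simp only [excess, Finset.range_zero, Finset.sum_empty, zero_sub, Set.mem_ofPred_eq] at ht
    linarith

/-- Elimination of the task `k` of longest period. The minimum `w` of the excess up to `-J k`
determines, by periodicity, the number `a` of jobs of task `k` up to the response time; with `a`
known, they can be charged to `g`. -/
theorem isLeast_response_succ {k : ℕ} {g w a t : ℤ} (hp : ∀ i ≤ k, 0 < p i) (hc : 0 ≤ c k)
    (hd : ∀ i ≤ k, p i ∣ p k) (hs : 0 < slack c p (k + 1) (p k))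
    (hw : IsMinExcess c p J (k + 1) (-J k) w) (ha : a = cdiv (g + w) (slack c p (k + 1) (p k)))
    (ht : IsLeast {t | g + c k * a + excess c p J k t ≤ 0} t) :
    IsLeast {t | g + excess c p J (k + 1) t ≤ 0} t := by
  have hpk := hp k le_rfl
  -- The times up to the `z`-th breakpoint include a solution exactly when `a ≤ z`.
  have key : ∀ z, (∃ r ≤ -J k + z * p k, excess c p J (k + 1) r ≤ -g) ↔ a ≤ z := by
    intro z
    have := hw.add_mul (q := p k) (fun i hi => hp i (by omega)) (fun i hi => hd i (by omega)) z
    rw [this, ha, cdiv_le_iff hs]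
    constructor <;> intro h <;> linarith
  have lower : ∀ s, excess c p J (k + 1) s ≤ -g → a ≤ cdiv (s + J k) (p k) := by
    intro s h
    refine (key _).1 ⟨s, ?_, h⟩
    have := le_cdiv_mul hpk (s + J k)
    linarith
  constructor
  · obtain ⟨r, hr, h⟩ := (key a).2 le_rfl
    have h2 : cdiv (r + J k) (p k) = a :=
      le_antisymm ((cdiv_le_iff hpk _ _).2 (by linarith)) (lower r h)
    have h3 : t ≤ r := by
      apply ht.2
      rw [excess_succ, h2] at h
      simp only [Set.mem_ofPred_eq]; linarith
    have h4 : cdiv (t + J k) (p k) ≤ a := (cdiv_le_iff hpk _ _).2 (by linarith)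
    have h5 := mul_le_mul_of_nonneg_left h4 hc
    have h6 : g + c k * a + excess c p J k t ≤ 0 := ht.1
    simp only [Set.mem_ofPred_eq, excess_succ]; linarith
  · intro s h
    simp only [Set.mem_ofPred_eq] at h
    have h5 := mul_le_mul_of_nonneg_left (lower s (by linarith)) hc
    apply ht.2
    rw [excess_succ] at h
    simp only [Set.mem_ofPred_eq]; linarith

end Demand

/-! ### Total correctness with step bounds -/

/-- Started in `σ`, the program `s` halts after at most `B` steps in a state satisfying `Q`. -/
def Runs (s : Prog) (B : ℕ) (σ : State) (Q : State → Prop) : Prop :=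
  ∃ (σ' : State) (T : ℕ), Exec s σ σ' T ∧ T ≤ B ∧ Q σ'

namespace Runs

variable {s t : Prog} {b : Cond} {σ : State} {B B' : ℕ} {Q Q' : State → Prop}

theorem le (h : Runs s B σ Q) (hB : B ≤ B') : Runs s B' σ Q := by
  obtain ⟨σ', T, h1, h2, h3⟩ := h
  exact ⟨σ', T, h1, h2.trans hB, h3⟩

theorem imp (h : Runs s B σ Q) (hQ : ∀ σ', Q σ' → Q' σ') : Runs s B σ Q' := by
  obtain ⟨σ', T, h1, h2, h3⟩ := h
  exact ⟨σ', T, h1, h2, hQ _ h3⟩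

theorem skip (h : Q σ) : Runs .skip 1 σ Q :=
  ⟨σ, 1, .skip σ, le_rfl, h⟩

theorem assign {x : ℕ} {e : Expr} (h : Q (σ.setVar x (e.eval σ))) :
    Runs (.assign x e) (e.cost + 1) σ Q :=
  ⟨_, _, .assign x e σ, le_rfl, h⟩

theorem write {a : ℕ} {k e : Expr} (h : Q (σ.setArr a (k.eval σ) (e.eval σ))) :
    Runs (.write a k e) (k.cost + e.cost + 1) σ Q :=
  ⟨_, _, .write a k e σ, le_rfl, h⟩

theorem seq (h : Runs s B σ fun σ' => Runs t B' σ' Q) : Runs (.seq s t) (B + B') σ Q := by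
  obtain ⟨σ₁, T, h1, h2, σ₂, T', h3, h4, h5⟩ := h
  exact ⟨σ₂, T + T', .seq h1 h3, add_le_add h2 h4, h5⟩

theorem ite (h : b.Holds σ → Runs s B σ Q) (h' : ¬ b.Holds σ → Runs t B' σ Q) :
    Runs (.ite b s t) (b.cost + 1 + (B + B')) σ Q := by
  by_cases hb : b.Holds σ
  · obtain ⟨σ', T, h1, h2, h3⟩ := h hb
    exact ⟨σ', _, .ite_true hb h1, by omega, h3⟩
  · obtain ⟨σ', T, h1, h2, h3⟩ := h' hb
    exact ⟨σ', _, .ite_false hb h1, by omega, h3⟩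

/-- A loop whose invariant `Inv k` is indexed by a counter that runs from `k` to `N`. -/
theorem loop (Inv : ℕ → State → Prop) {N k : ℕ} (hk : k ≤ N)
    (hstep : ∀ i, k ≤ i → i < N → ∀ σ, Inv i σ → b.Holds σ ∧ Runs s B σ (Inv (i + 1)))
    (hend : ∀ σ, Inv N σ → ¬ b.Holds σ) (h : Inv k σ) :
    Runs (.while b s) (N * (b.cost + 1 + B) + (b.cost + 1)) σ (Inv N) := by
  suffices H : ∀ d i σ, k ≤ i → i + d = N → Inv i σ →
      Runs (.while b s) (d * (b.cost + 1 + B) + (b.cost + 1)) σ (Inv N) from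
    (H (N - k) k σ le_rfl (by omega) h).le (by gcongr; omega)
  intro d
  induction d with
  | zero =>
    intro i σ _ hi h
    obtain rfl : i = N := by omega
    exact ⟨σ, _, .while_false (hend σ h), by omega, h⟩
  | succ d ih =>
    intro i σ hki hi h
    obtain ⟨hb, σ₁, T, h1, h2, h3⟩ := hstep i hki (by omega) σ h
    obtain ⟨σ₂, T', h4, h5, h6⟩ := ih (i + 1) σ₁ (by omega) (by omega) h3
    exact ⟨σ₂, _, .while_true hb h1 h4, by rw [Nat.succ_mul]; omega, h6⟩

end Runs

/-! ### The program -/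

/-- Exchange the cells of array `a` whose indices are in the variables `3` and `4`, by way of
variable `5`. -/
def swapCells (a : ℕ) : Prog :=
  .seq (.assign 5 (.read a (.var 3)))
    (.seq (.write a (.var 3) (.read a (.var 4)))
      (.write a (.var 4) (.var 5)))

/-- Increase variable `x` by one. -/
def incr (x : ℕ) : Prog :=
  .assign x (.add (.var x) (.const 1))

/-- The test `x < |I|` for the variable `x`. -/
def below (x : ℕ) : Cond :=
  .le (.add (.var x) (.const 1)) (.var 0)

/-- Body of the inner loop of the exchange sort. -/
def sortStep : Prog :=
  .seq
    (.ite (.le (.read 1 (.var 3)) (.read 1 (.var 4)))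
      .skip
      (.seq (swapCells 0) (.seq (swapCells 1) (swapCells 2))))
    (incr 4)

/-- Exchange sort of the tasks by period, with the loop variables `3` and `4`. -/
def sortProg : Prog :=
  .seq (.assign 3 (.const 0))
    (.while (below 3)
      (.seq (.assign 4 (.add (.var 3) (.const 1)))
        (.seq (.while (below 4) sortStep)
          (incr 3))))

/-- Update of the table entry `j` (variable `4`) by task `k` (variable `3`). Variable `8` holds the
capacity that the tasks before `k` leave in a window of length `p k`, and the entry is the minimum
of the excess up to `-J j`, minus `J j`. -/
def tableStep : Prog :=
  .seq
    (.assign 9 (.sub (.const 0)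
      (.div (.sub (.read 2 (.var 4)) (.read 2 (.var 3))) (.read 1 (.var 3)))))
    (.seq
      (.assign 10 (.add (.mul (.read 0 (.var 3)) (.var 9)) (.read 3 (.var 4))))
      (.seq
        (.assign 11 (.sub (.add (.mul (.read 0 (.var 3)) (.sub (.var 9) (.const 1)))
            (.sub (.add (.read 3 (.var 3)) (.read 2 (.var 3)))
              (.mul (.sub (.var 9) (.const 1)) (.var 8))))
          (.read 2 (.var 4))))
        (.seq
          (.ite (.le (.var 10) (.var 11))
            (.write 3 (.var 4) (.var 10))
            (.write 3 (.var 4) (.var 11)))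
          (incr 4))))

/-- Tabulation of the minima of the excess in array `3`, and of the capacities left by the tasks
`0, …, k` in a window of length `p k` in array `4`. Variable `6` holds the previous period and
variable `7` the capacity left in a window of that length. -/
def tableProg : Prog :=
  .seq (.assign 3 (.const 0))
    (.seq (.assign 6 (.const 1))
      (.seq (.assign 7 (.const 1))
        (.while (below 3)
          (.seq (.assign 8 (.mul (.div (.read 1 (.var 3)) (.var 6)) (.var 7)))
            (.seq (.assign 4 (.add (.var 3) (.const 1)))
              (.seq (.while (below 4) tableStep)
                (.seq (.assign 6 (.read 1 (.var 3)))
                  (.seq (.assign 7 (.sub (.var 8) (.read 0 (.var 3))))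
                    (.seq (.write 4 (.var 3) (.var 7))
                      (incr 3))))))))))

/-- Elimination of the tasks in the order of decreasing periods. Variable `1`, which holds `γ` at
first, collects the demand of the eliminated tasks. -/
def eliminateProg : Prog :=
  .while (.le (.const 1) (.var 3))
    (.seq (.assign 3 (.sub (.var 3) (.const 1)))
      (.assign 1 (.add (.var 1) (.mul (.read 0 (.var 3))
        (.sub (.const 0) (.div
          (.sub (.const 0) (.add (.var 1) (.add (.read 3 (.var 3)) (.read 2 (.var 3)))))
          (.read 4 (.var 3))))))))

/-- The program that computes the response time. -/
def responseProg : Prog :=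
  .seq sortProg (.seq tableProg (.seq eliminateProg (.assign 2 (.var 1))))

/-! ### Sorting -/

/-- The memory holds `m` tasks with the given parameters in the input arrays. -/
structure Loaded (m : ℕ) (c p J : ℕ → ℤ) (σ : State) : Prop where
  size : σ.var 0 = m
  exec : ∀ k < m, σ.arr 0 k = c k
  period : ∀ k < m, σ.arr 1 k = p k
  jitter : ∀ k < m, σ.arr 2 k = J k

theorem runs_swapCells {a i j : ℕ} {σ : State} (hi : σ.var 3 = i) (hj : σ.var 4 = j) :
    Runs (swapCells a) 10 σ fun σ' =>
      (∀ k : ℕ, σ'.arr a k = σ.arr a (Equiv.swap i j k : ℕ)) ∧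
      (∀ a' ≠ a, σ'.arr a' = σ.arr a') ∧ ∀ x ≠ 5, σ'.var x = σ.var x := by
  refine Runs.le (Runs.seq (Runs.assign (Runs.seq (Runs.write (Runs.write ⟨?_, ?_, ?_⟩)))))
    (by simp [Expr.cost])
  · intro k
    by_cases hki : k = i <;> by_cases hkj : k = j <;>
      simp_all [Expr.eval, State.setVar, State.setArr,
        Equiv.swap_apply_def]
  · intro a' ha'
    simp [State.setArr, State.setVar, Function.update_of_ne ha']
  · intro x hx
    simp [State.setArr, State.setVar, Function.update_of_ne hx]

/-- The outer invariant of the exchange sort: the tasks are permuted by `e`, and the first `i` of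
them are in their final places. -/
structure SortInv (m : ℕ) (c p J : ℕ → ℤ) (γ : ℤ) (i : ℕ) (e : Equiv.Perm ℕ) (σ : State) :
    Prop where
  loaded : Loaded m (c ∘ e) (p ∘ e) (J ∘ e) σ
  perm : ∀ k, e k < m ↔ k < m
  gamma : σ.var 1 = γ
  zero : ∀ k, σ.arr 3 k = 0
  index : σ.var 3 = i
  sorted : ∀ a < i, ∀ b, a < b → b < m → p (e a) ≤ p (e b)

theorem runs_sortStep {m : ℕ} {c p J : ℕ → ℤ} {γ : ℤ} {i j : ℕ} {e : Equiv.Perm ℕ} {σ : State}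
    (hij : i < j) (hj : j < m) (h : SortInv m c p J γ i e σ) (hσ : σ.var 4 = j)
    (hmin : ∀ b, i < b → b < j → p (e i) ≤ p (e b)) :
    Runs sortStep 41 σ fun σ' => ∃ e, SortInv m c p J γ i e σ' ∧ σ'.var 4 = (j + 1 : ℕ) ∧
      ∀ b, i < b → b < j + 1 → p (e i) ≤ p (e b) := by
  have hi : i < m := hij.trans hj
  have hcmp : (Cond.le (.read 1 (.var 3)) (.read 1 (.var 4))).Holds σ ↔ p (e i) ≤ p (e j) := by
    simp only [Cond.Holds, Expr.eval, h.index, hσ, h.loaded.period i hi, h.loaded.period j hj,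
      Function.comp_apply]
  refine Runs.le (Runs.seq (B := 37) (B' := 4) (Runs.le (Runs.ite (B := 1) (B' := 30)
    (fun hb => Runs.skip ?_) (fun hb => ?_)) (by decide))) le_rfl
  · rw [hcmp] at hb
    refine Runs.assign ⟨e, ⟨⟨?_, ?_, ?_, ?_⟩, h.perm, ?_, ?_, ?_, h.sorted⟩, ?_, ?_⟩
    · simpa [State.setVar] using h.loaded.size
    · simpa [State.setVar] using h.loaded.exec
    · simpa [State.setVar] using h.loaded.period
    · simpa [State.setVar] using h.loaded.jitter
    · simpa [State.setVar] using h.gamma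
    · simpa [State.setVar] using h.zero
    · simpa [State.setVar] using h.index
    · simp [State.setVar, Expr.eval, hσ]
    · intro b hb1 hb2
      rcases Nat.lt_succ_iff_lt_or_eq.1 hb2 with h' | rfl
      exacts [hmin b hb1 h', hb]
  · rw [hcmp, not_le] at hb
    refine Runs.seq (B := 10) (B' := 20) ((runs_swapCells h.index hσ).imp ?_)
    rintro σ₁ ⟨ha, hA, hv⟩
    refine Runs.seq (B := 10) (B' := 10) ((runs_swapCells (i := i) (j := j)
      (by rw [hv 3 (by decide), h.index]) (by rw [hv 4 (by decide), hσ])).imp ?_)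
    rintro σ₂ ⟨ha₂, hA₂, hv₂⟩
    refine (runs_swapCells (i := i) (j := j)
      (by rw [hv₂ 3 (by decide), hv 3 (by decide), h.index])
      (by rw [hv₂ 4 (by decide), hv 4 (by decide), hσ])).imp ?_
    rintro σ₃ ⟨ha₃, hA₃, hv₃⟩
    have hswap : ∀ k, Equiv.swap i j k < m ↔ k < m := by
      intro k
      rw [Equiv.swap_apply_def]
      split_ifs <;> omega
    have hV : ∀ x ≠ 5, σ₃.var x = σ.var x := fun x hx => by rw [hv₃ x hx, hv₂ x hx, hv x hx]
    refine Runs.assign ⟨(Equiv.swap i j).trans e, ⟨⟨?_, ?_, ?_, ?_⟩, ?_, ?_, ?_, ?_, ?_⟩, ?_, ?_⟩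
    · simpa [State.setVar, hV] using h.loaded.size
    · intro k hk
      simp only [State.setVar, hA₃ 0 (by decide), hA₂ 0 (by decide), ha]
      exact h.loaded.exec _ ((hswap k).2 hk)
    · intro k hk
      simp only [State.setVar, hA₃ 1 (by decide), ha₂, hA 1 (by decide)]
      exact h.loaded.period _ ((hswap k).2 hk)
    · intro k hk
      simp only [State.setVar, ha₃, hA₂ 2 (by decide), hA 2 (by decide)]
      exact h.loaded.jitter _ ((hswap k).2 hk)
    · intro k
      rw [Equiv.trans_apply, h.perm, hswap]
    · simpa [State.setVar, hV] using h.gamma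
    · intro k
      simpa [State.setVar, hA₃ 3 (by decide), hA₂ 3 (by decide), hA 3 (by decide)] using h.zero k
    · simpa [State.setVar, hV] using h.index
    · intro a hai b hab hbm
      rw [Equiv.trans_apply, Equiv.trans_apply,
        Equiv.swap_apply_of_ne_of_ne (by omega : a ≠ i) (by omega : a ≠ j)]
      refine h.sorted a hai _ ?_ ((hswap b).2 hbm)
      rw [Equiv.swap_apply_def]
      split_ifs <;> omega
    · simp [State.setVar, Expr.eval, hV, hσ]
    · intro b hb1 hb2
      rw [Equiv.trans_apply, Equiv.trans_apply, Equiv.swap_apply_left]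
      rcases Nat.lt_succ_iff_lt_or_eq.1 hb2 with h' | rfl
      · rw [Equiv.swap_apply_of_ne_of_ne (by omega) (by omega)]
        exact hb.le.trans (hmin b hb1 h')
      · rw [Equiv.swap_apply_right]; exact hb.le

theorem holds_below {x : ℕ} {m k : ℕ} {σ : State} (hm : σ.var 0 = m) (hk : σ.var x = k) :
    (below x).Holds σ ↔ k < m := by
  simp only [below, Cond.Holds, Expr.eval, hm, hk]
  omega

theorem runs_sortProg {m : ℕ} {c p J : ℕ → ℤ} {γ : ℤ} {σ : State} (h : Loaded m c p J σ)
    (hγ : σ.var 1 = γ) (h3 : ∀ k, σ.arr 3 k = 0) :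
    Runs sortProg (m * (m * 47 + 20) + 8) σ fun σ' => ∃ e, SortInv m c p J γ m e σ' := by
  refine Runs.le (Runs.seq (Runs.assign (Runs.loop (B := m * 47 + 14)
    (fun i σ => ∃ e, SortInv m c p J γ i e σ) (Nat.zero_le m) ?_ ?_ ?_)))
    (by simp only [below, Cond.cost, Expr.cost]; ring_nf; omega)
  · rintro i - him σ ⟨e, h⟩
    refine ⟨(holds_below h.loaded.size h.index).2 him, ?_⟩
    refine Runs.le (Runs.seq (Runs.assign (Runs.seq (Runs.imp (Runs.loop (B := 41)
      (fun j σ => ∃ e, SortInv m c p J γ i e σ ∧ σ.var 4 = j ∧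
        ∀ b, i < b → b < j → p (e i) ≤ p (e b))
      (Nat.succ_le_of_lt him) ?_ ?_ ?_) fun σ h => Runs.assign ?_))))
      (by simp only [below, Cond.cost, Expr.cost]; ring_nf; omega)
    · rintro j hij hjm σ ⟨e, h, hσ, hmin⟩
      exact ⟨(holds_below h.loaded.size hσ).2 hjm, runs_sortStep hij hjm h hσ hmin⟩
    · rintro σ ⟨e, h, hσ, -⟩
      rw [holds_below h.loaded.size hσ]
      exact lt_irrefl m
    · refine ⟨e, ⟨⟨?_, ?_, ?_, ?_⟩, h.perm, ?_, ?_, ?_, h.sorted⟩, ?_, ?_⟩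
      · simpa [State.setVar] using h.loaded.size
      · simpa [State.setVar] using h.loaded.exec
      · simpa [State.setVar] using h.loaded.period
      · simpa [State.setVar] using h.loaded.jitter
      · simpa [State.setVar] using h.gamma
      · simpa [State.setVar] using h.zero
      · simpa [State.setVar] using h.index
      · simp [State.setVar, Expr.eval, h.index]
      · intro b hb1 hb2; omega
    · obtain ⟨e, h, -, hmin⟩ := h
      refine ⟨e, ⟨⟨?_, ?_, ?_, ?_⟩, h.perm, ?_, ?_, ?_, ?_⟩⟩
      · simpa [State.setVar] using h.loaded.size
      · simpa [State.setVar] using h.loaded.exec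
      · simpa [State.setVar] using h.loaded.period
      · simpa [State.setVar] using h.loaded.jitter
      · simpa [State.setVar] using h.gamma
      · simpa [State.setVar] using h.zero
      · simp [State.setVar, Expr.eval, h.index]
      · intro a ha b hab hb
        rcases Nat.lt_succ_iff_lt_or_eq.1 ha with h' | rfl
        exacts [h.sorted a h' b hab hb, hmin b hab hb]
  · rintro σ ⟨e, h⟩
    rw [holds_below h.loaded.size h.index]
    exact lt_irrefl m
  · refine ⟨1, ⟨⟨?_, ?_, ?_, ?_⟩, fun _ => Iff.rfl, ?_, ?_, ?_, ?_⟩⟩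
    · simpa [State.setVar] using h.size
    · simpa [State.setVar] using h.exec
    · simpa [State.setVar] using h.period
    · simpa [State.setVar] using h.jitter
    · simpa [State.setVar] using hγ
    · simpa [State.setVar] using h3
    · simp [State.setVar, Expr.eval]
    · intro a ha; omega

/-! ### Tabulation of the minima -/

/-- The parameters of `m` tasks, sorted by their harmonic periods, with utilization below `1`. -/
structure Admissible (m : ℕ) (c p : ℕ → ℤ) : Prop where
  exec_nonneg : ∀ k < m, 0 ≤ c k
  period_pos : ∀ k < m, 0 < p k
  dvd : ∀ i k, i ≤ k → k < m → p i ∣ p k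
  util : ∀ k ≤ m, ∑ i ∈ Finset.range k, (c i : ℚ) / (p i : ℚ) < 1

theorem Admissible.slack_pos {m k : ℕ} {c p : ℕ → ℤ} (h : Admissible m c p) (hk : k < m) :
    0 < slack c p (k + 1) (p k) :=
  RTC.slack_pos (h.period_pos k hk) (fun i hi => h.dvd i k (by omega) hk) (h.util _ hk)

/-- Array `3` holds the minima of the excess of the first `f l` tasks up to `-J l`, minus `J l`.
With this normalization the table for no tasks is zero, as in the initial memory. -/
def TableInv (m : ℕ) (c p J : ℕ → ℤ) (f : ℕ → ℕ) (σ : State) : Prop :=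
  ∀ l < m, IsMinExcess c p J (f l) (-J l) (σ.arr 3 l + J l)

/-- Array `4` holds the capacities left by the tasks `0, …, l` in a window of length `p l`. -/
def SlackInv (k : ℕ) (c p : ℕ → ℤ) (σ : State) : Prop :=
  ∀ l < k, σ.arr 4 l = slack c p (l + 1) (p l)

/-- The invariant of the inner loop of the tabulation at task `k` and entry `j`. The entry `k` never
changes at task `k` and serves as the minimum for `k` tasks (`pivot`) and for `k + 1` tasks
(`table`); entries below `k` are final. -/
structure RowInv (m : ℕ) (c p J : ℕ → ℤ) (γ : ℤ) (k j : ℕ) (σ : State) : Prop where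
  loaded : Loaded m c p J σ
  gamma : σ.var 1 = γ
  index : σ.var 3 = k
  entry : σ.var 4 = j
  window : σ.var 8 = slack c p k (p k)
  slacks : SlackInv k c p σ
  pivot : IsMinExcess c p J k (-J k) (σ.arr 3 k + J k)
  table : TableInv m c p J (fun l => if l < j then min (k + 1) (l + 1) else k) σ

theorem runs_tableStep {m : ℕ} {c p J : ℕ → ℤ} {γ : ℤ} {k j : ℕ} {σ : State}
    (hA : Admissible m c p) (hkj : k < j) (hj : j < m) (h : RowInv m c p J γ k j σ) :
    Runs tableStep 55 σ (RowInv m c p J γ k (j + 1)) := by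
  have hk : k < m := hkj.trans hj
  have hpk : ∀ i ≤ k, 0 < p i := fun i hi => hA.period_pos i (by omega)
  have hdk : ∀ i ≤ k, p i ∣ p k := fun i hi => hA.dvd i k hi hk
  have hu := h.table j hj
  simp only [lt_irrefl, if_false] at hu
  obtain ⟨a, ha⟩ : ∃ a, a = -((J j - J k) / p k) := ⟨_, rfl⟩
  have hmin := IsMinExcess.succ_of_table hpk (hA.exec_nonneg k hk) hdk
    (hA.slack_pos hk).le (a := a) (by rw [ha, cdiv]; congr 2; ring) hu h.pivot
  obtain ⟨u, hu'⟩ : ∃ u, u = c k * a + σ.arr 3 j := ⟨_, rfl⟩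
  obtain ⟨v, hv'⟩ : ∃ v, v = c k * (a - 1) +
      (σ.arr 3 k + J k - (a - 1) * slack c p k (p k)) - J j := ⟨_, rfl⟩
  -- Both branches of the conditional lead to a state of this kind.
  have key : ∀ σ', (∀ x, x ≤ 8 → x ≠ 4 → σ'.var x = σ.var x) → σ'.var 4 = ((j + 1 : ℕ) : ℤ) →
      (∀ b ≠ 3, σ'.arr b = σ.arr b) → σ'.arr 3 = Function.update (σ.arr 3) j (min u v) →
      RowInv m c p J γ k (j + 1) σ' := by
    intro σ' hV h4 hA' h3
    have h3' : ∀ l : ℕ, l ≠ j → σ'.arr 3 l = σ.arr 3 l := fun l hl => by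
      rw [h3, Function.update_of_ne (by exact_mod_cast hl)]
    refine ⟨⟨?_, ?_, ?_, ?_⟩, ?_, ?_, h4, ?_, ?_, ?_, ?_⟩
    · rw [hV 0 (by decide) (by decide), h.loaded.size]
    · rw [hA' 0 (by decide)]; exact h.loaded.exec
    · rw [hA' 1 (by decide)]; exact h.loaded.period
    · rw [hA' 2 (by decide)]; exact h.loaded.jitter
    · rw [hV 1 (by decide) (by decide), h.gamma]
    · rw [hV 3 (by decide) (by decide), h.index]
    · rw [hV 8 (by decide) (by decide), h.window]
    · intro l hl; rw [hA' 4 (by decide)]; exact h.slacks l hl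
    · rw [h3' k hkj.ne]; exact h.pivot
    · intro l hl
      by_cases hlj : l = j
      · subst hlj
        have e1 : min u v + J l = min (c k * a + (σ.arr 3 l + J l))
            (c k * (a - 1) + (σ.arr 3 k + J k - (a - 1) * slack c p k (p k))) := by
          rw [hu', hv', min_add]; congr 1 <;> ring
        simp only [Nat.lt_succ_self, if_true, h3, Function.update_self, e1]
        rwa [min_eq_left (by omega)]
      · have e1 : (if l < j + 1 then min (k + 1) (l + 1) else k)
            = if l < j then min (k + 1) (l + 1) else k := by
          split_ifs <;> omega
        simp only [e1, h3' l hlj]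
        exact h.table l hl
  have hc1 : σ.arr 0 k = c k := h.loaded.exec k hk
  have hp1 : σ.arr 1 k = p k := h.loaded.period k hk
  have hJ1 : σ.arr 2 k = J k := h.loaded.jitter k hk
  have hJ2 : σ.arr 2 j = J j := h.loaded.jitter j hj
  have hi := h.index
  have hj4 := h.entry
  have hD := h.window
  refine Runs.le (B := ?B) ?run ?cost
  case run =>
    refine Runs.seq (Runs.assign (Runs.seq (Runs.assign (Runs.seq (Runs.assign
      (Runs.seq (Runs.ite (fun hb => Runs.write (Runs.assign ?_))
        (fun hb => Runs.write (Runs.assign ?_)))))))))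
    all_goals
      simp [Cond.Holds, Expr.eval, State.setVar, hc1, hp1, hJ1, hJ2, hi, hj4, hD, ← ha, ← hu',
        ← hv'] at hb
      apply key <;>
        simp [Expr.eval, State.setVar, State.setArr, hc1, hp1, hJ1, hJ2, hi, hj4, hD,
          ← ha, ← hu', ← hv', hb, le_of_lt]
      · intro x hx _
        repeat rw [Function.update_of_ne (by omega)]
    all_goals
      intro b hb3
      simp [hb3]
  case cost => decide

/-- The outer invariant of the tabulation, before task `k` is processed. -/
structure TabInv (m : ℕ) (c p J : ℕ → ℤ) (γ : ℤ) (k : ℕ) (σ : State) : Prop where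
  loaded : Loaded m c p J σ
  gamma : σ.var 1 = γ
  index : σ.var 3 = k
  prev_pos : 0 < σ.var 6
  dvd_prev : ∀ i < k, p i ∣ σ.var 6
  prev_dvd : ∀ l, k ≤ l → l < m → σ.var 6 ∣ p l
  window : σ.var 7 = slack c p k (σ.var 6)
  slacks : SlackInv k c p σ
  table : TableInv m c p J (fun l => min k (l + 1)) σ

/-- One pass of the outer loop of `tableProg`. -/
theorem runs_tableRow {m : ℕ} {c p J : ℕ → ℤ} {γ : ℤ} {k : ℕ} {σ : State}
    (hA : Admissible m c p) (hk : k < m) (h : TabInv m c p J γ k σ) :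
    Runs (.seq (.assign 8 (.mul (.div (.read 1 (.var 3)) (.var 6)) (.var 7)))
            (.seq (.assign 4 (.add (.var 3) (.const 1)))
              (.seq (.while (below 4) tableStep)
                (.seq (.assign 6 (.read 1 (.var 3)))
                  (.seq (.assign 7 (.sub (.var 8) (.read 0 (.var 3))))
                    (.seq (.write 4 (.var 3) (.var 7))
                      (incr 3))))))) (m * 61 + 36) σ (TabInv m c p J γ (k + 1)) := by
  have hpk : ∀ i ≤ k, 0 < p i := fun i hi => hA.period_pos i (by omega)
  have hdk : ∀ i ≤ k, p i ∣ p k := fun i hi => hA.dvd i k hi hk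
  have hp1 := h.loaded.period k hk
  have hwin : p k / σ.var 6 * σ.var 7 = slack c p k (p k) := by
    rw [h.window, ← slack_mul h.dvd_prev, Int.ediv_mul_cancel (h.prev_dvd k le_rfl hk)]
  have hslack : slack c p k (p k) - c k = slack c p (k + 1) (p k) := by
    rw [slack_succ, Int.ediv_self (hpk k le_rfl).ne', mul_one]
  refine Runs.le (B := ?B) ?run ?cost
  case run =>
    refine Runs.seq (Runs.assign (Runs.seq (Runs.assign (Runs.seq (Runs.imp (Runs.loop (B := 55)
      (fun j σ => RowInv m c p J γ k j σ) (Nat.succ_le_of_lt hk) ?_ ?_ ?_)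
      (fun σ h => Runs.seq (Runs.assign (Runs.seq (Runs.assign
        (Runs.seq (Runs.write (Runs.assign ?_))))))))))))
    · intro j hkj hj σ h
      exact ⟨(holds_below h.loaded.size h.entry).2 hj, runs_tableStep hA hkj hj h⟩
    · intro σ h
      rw [holds_below h.loaded.size h.entry]
      exact lt_irrefl m
    · refine ⟨⟨?_, ?_, ?_, ?_⟩, ?_, ?_, ?_, ?_, ?_, ?_, ?_⟩
      · simpa [State.setVar] using h.loaded.size
      · simpa [State.setVar] using h.loaded.exec
      · simpa [State.setVar] using h.loaded.period
      · simpa [State.setVar] using h.loaded.jitter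
      · simpa [State.setVar] using h.gamma
      · simpa [State.setVar] using h.index
      · simp [State.setVar, Expr.eval, h.index]
      · simp [State.setVar, Expr.eval, h.index, hp1, hwin]
      · simpa [State.setVar, SlackInv] using h.slacks
      · have := h.table k hk
        dsimp only at this
        rw [min_eq_left (by omega)] at this
        simpa [State.setVar] using this
      · intro l hl
        have := h.table l hl
        dsimp only at this
        by_cases hlk : l < k + 1
        · simp only [hlk, if_true, State.setVar]
          rcases Nat.lt_succ_iff_lt_or_eq.1 hlk with h' | rfl
          · rw [min_eq_right (by omega)] at this
            rwa [min_eq_right (by omega)]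
          · rw [min_eq_left (by omega)] at this
            rw [min_self]
            exact IsMinExcess.succ_self hpk (hA.exec_nonneg _ hk) hdk (hA.slack_pos hk).le this
        · rw [min_eq_left (by omega)] at this
          simpa only [hlk, if_false, State.setVar] using this
    · have hc1 := h.loaded.exec k hk
      have hp1 := h.loaded.period k hk
      have hi := h.index
      have hD := h.window
      refine ⟨⟨?_, ?_, ?_, ?_⟩, ?_, ?_, ?_, ?_, ?_, ?_, ?_, ?_⟩
      · simpa [State.setVar, State.setArr] using h.loaded.size
      · simpa [State.setVar, State.setArr] using h.loaded.exec
      · simpa [State.setVar, State.setArr] using h.loaded.period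
      · simpa [State.setVar, State.setArr] using h.loaded.jitter
      · simpa [State.setVar, State.setArr] using h.gamma
      · simp [State.setVar, State.setArr, Expr.eval, hi]
      · simpa [State.setVar, State.setArr, Expr.eval, hi, hp1] using hpk k le_rfl
      · intro i hik
        simpa [State.setVar, State.setArr, Expr.eval, hi, hp1] using hdk i (by omega)
      · intro l hkl hl
        simpa [State.setVar, State.setArr, Expr.eval, hi, hp1] using hA.dvd k l (by omega) hl
      · simp [State.setVar, State.setArr, Expr.eval, hi, hp1, hc1, hD, hslack]
      · intro l hl
        by_cases hlk : l = k
        · subst hlk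
          simp [State.setVar, State.setArr, Expr.eval, hi, hc1, hD, hslack]
        · simpa [State.setVar, State.setArr, Expr.eval, hi, hlk] using h.slacks l (by omega)
      · intro l hl
        have := h.table l hl
        dsimp only at this
        simp only [hl, if_true] at this
        simpa [State.setVar, State.setArr] using this
  case cost => simp only [below, Cond.cost, Expr.cost]; omega

theorem runs_tableProg {m : ℕ} {c p J : ℕ → ℤ} {γ : ℤ} {σ : State} (hA : Admissible m c p)
    (h : Loaded m c p J σ) (hγ : σ.var 1 = γ) (h3 : ∀ k : ℕ, σ.arr 3 k = 0) :
    Runs tableProg (m * (m * 61 + 42) + 12) σ (TabInv m c p J γ m) := by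
  refine Runs.le (B := ?B) ?run ?cost
  case run =>
    refine Runs.seq (Runs.assign (Runs.seq (Runs.assign (Runs.seq (Runs.assign
      (Runs.loop (B := m * 61 + 36) (fun k σ => TabInv m c p J γ k σ) (Nat.zero_le m)
        ?_ ?_ ?_))))))
    · intro k _ hk σ h
      exact ⟨(holds_below h.loaded.size h.index).2 hk, runs_tableRow hA hk h⟩
    · intro σ h
      rw [holds_below h.loaded.size h.index]
      exact lt_irrefl m
    · refine ⟨⟨?_, ?_, ?_, ?_⟩, ?_, ?_, ?_, ?_, ?_, ?_, ?_, ?_⟩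
      · simpa [State.setVar] using h.size
      · simpa [State.setVar] using h.exec
      · simpa [State.setVar] using h.period
      · simpa [State.setVar] using h.jitter
      · simpa [State.setVar] using hγ
      · simp [State.setVar, Expr.eval]
      · simp [State.setVar, Expr.eval]
      · intro i hi; omega
      · intro l _ _
        simp [State.setVar, Expr.eval]
      · simp [State.setVar, Expr.eval, slack]
      · intro l hl; omega
      · intro l hl
        have := isMinExcess_zero (c := c) (p := p) (J := J) (-J l)
        simpa [State.setVar, h3] using this
  case cost => simp only [below, Cond.cost, Expr.cost]; ring_nf; omega

/-! ### Elimination -/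

/-- The invariant of the elimination when the tasks `k, …, m - 1` have been eliminated: a response
time for the remaining tasks and the current value of variable `1` is the response time sought. -/
structure ElimInv (m : ℕ) (c p J : ℕ → ℤ) (γ : ℤ) (k : ℕ) (σ : State) : Prop where
  loaded : Loaded m c p J σ
  index : σ.var 3 = k
  slacks : SlackInv m c p σ
  table : TableInv m c p J (· + 1) σ
  response : ∀ t, IsLeast {t | σ.var 1 + excess c p J k t ≤ 0} t →
    IsLeast {t | γ + excess c p J m t ≤ 0} t

theorem runs_eliminateProg {m : ℕ} {c p J : ℕ → ℤ} {γ : ℤ} {σ : State} (hA : Admissible m c p)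
    (h : TabInv m c p J γ m σ) :
    Runs eliminateProg (m * 28 + 4) σ fun σ' =>
      IsLeast {t | γ + excess c p J m t ≤ 0} (σ'.var 1) := by
  refine Runs.imp (Runs.loop (B := 24) (N := m)
    (fun r σ => ∃ k, k + r = m ∧ ElimInv m c p J γ k σ) (Nat.zero_le m) ?_ ?_ ?_) ?_
  · rintro r - hr σ ⟨k, hkr, h⟩
    obtain ⟨k, rfl⟩ : ∃ l, k = l + 1 := ⟨k - 1, by omega⟩
    have hk : k < m := by omega
    have hi := h.index
    push_cast at hi
    have hc1 := h.loaded.exec k hk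
    have hJ1 := h.loaded.jitter k hk
    have h4 := h.slacks k hk
    refine ⟨by simp [Cond.Holds, Expr.eval, hi], ?_⟩
    refine Runs.le (B := ?B) ?run ?cost
    case run =>
      refine Runs.seq (Runs.assign (Runs.assign ?_))
      refine ⟨k, by omega, ⟨?_, ?_, ?_, ?_⟩, ?_, ?_, ?_, ?_⟩
      · simpa [State.setVar] using h.loaded.size
      · simpa [State.setVar] using h.loaded.exec
      · simpa [State.setVar] using h.loaded.period
      · simpa [State.setVar] using h.loaded.jitter
      · simp [State.setVar, Expr.eval, hi]
      · simpa [State.setVar, SlackInv] using h.slacks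
      · simpa [State.setVar, TableInv] using h.table
      · intro t ht
        refine h.response t (isLeast_response_succ (fun i hi => hA.period_pos i (by omega))
          (hA.exec_nonneg k hk) (fun i hi => hA.dvd i k hi hk) (hA.slack_pos hk)
          (h.table k hk) rfl ?_)
        simpa [State.setVar, Expr.eval, hi, hc1, hJ1, h4, cdiv] using ht
    case cost => decide
  · rintro σ ⟨k, hk, h⟩
    obtain rfl : k = 0 := by omega
    simp [Cond.Holds, Expr.eval, h.index]
  · refine ⟨m, rfl, h.loaded, h.index, h.slacks, ?_, fun t ht => ?_⟩
    · intro l hl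
      have := h.table l hl
      dsimp only at this
      rwa [min_eq_right (by omega)] at this
    · rwa [h.gamma] at ht
  · rintro σ ⟨k, hk, h⟩
    obtain rfl : k = 0 := by omega
    exact h.response _ (isLeast_response_zero _)

/-! ### Correctness of the program -/

theorem runs_responseProg {m : ℕ} {c p J : ℕ → ℤ} {γ : ℤ} {σ : State} (h : Loaded m c p J σ)
    (hγ : σ.var 1 = γ) (h3 : ∀ k, σ.arr 3 k = 0) (hc : ∀ k < m, 0 ≤ c k) (hp : ∀ k < m, 0 < p k)
    (hd : ∀ i < m, ∀ j < m, p i ≤ p j → p i ∣ p j)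
    (hU : ∑ k ∈ Finset.range m, (c k : ℚ) / (p k : ℚ) < 1) :
    Runs responseProg (198 * m ^ 2 + 26) σ fun σ' =>
      IsLeast {t | γ + excess c p J m t ≤ 0} σ'.output := by
  have hm : m ≤ m ^ 2 := Nat.le_self_pow two_ne_zero m
  refine Runs.le (Runs.seq (Runs.imp (runs_sortProg h hγ h3) ?_))
    (B := m * (m * 47 + 20) + 8 + (m * (m * 61 + 42) + 12 + (m * 28 + 4 + 2))) (by nlinarith)
  rintro σ₁ ⟨e, h₁⟩
  have hsum : ∀ {M : Type} [AddCommMonoid M] (f : ℕ → M),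
      ∑ k ∈ Finset.range m, f (e k) = ∑ k ∈ Finset.range m, f k := fun f =>
    Finset.sum_equiv e (by simp [h₁.perm]) (fun _ _ => rfl)
  have hA : Admissible m (c ∘ e) (p ∘ e) := by
    refine ⟨fun k hk => hc _ ((h₁.perm k).2 hk), fun k hk => hp _ ((h₁.perm k).2 hk), ?_, ?_⟩
    · intro i k hik hk
      rcases hik.eq_or_lt with rfl | hlt
      · exact dvd_rfl
      · exact hd _ ((h₁.perm i).2 (by omega)) _ ((h₁.perm k).2 hk)
          (h₁.sorted i (by omega) k hlt hk)
    · intro k hk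
      refine lt_of_le_of_lt (Finset.sum_le_sum_of_subset_of_nonneg
        (Finset.range_subset_range.2 hk) fun i hi _ => ?_)
        ((hsum fun k => (c k : ℚ) / (p k : ℚ)).trans_lt hU)
      have hi := (h₁.perm i).2 (Finset.mem_range.1 hi)
      have h1 : (0 : ℚ) ≤ c (e i) := by exact_mod_cast hc _ hi
      have h2 : (0 : ℚ) < p (e i) := by exact_mod_cast hp _ hi
      exact div_nonneg h1 h2.le
  refine Runs.seq (Runs.imp (runs_tableProg hA h₁.loaded h₁.gamma fun k => h₁.zero k) fun σ₂ h₂ =>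
    Runs.seq (Runs.imp (runs_eliminateProg hA h₂) fun σ₃ h₃ => Runs.assign ?_))
  have hex : ∀ t, excess (c ∘ e) (p ∘ e) (J ∘ e) m t = excess c p J m t := fun t => by
    simp only [excess, Function.comp_apply]
    rw [hsum fun k => c k * cdiv (t + J k) (p k)]
  simpa [State.output, State.setVar, Expr.eval, hex] using h₃

theorem listing_eq {n : ℕ} (I : Finset (Fin n)) (f : Fin n → ℕ) (k : Fin I.card) :
    listing I f ((k : ℕ) : ℤ) = f (I.orderIsoOfFin rfl k) := by
  simp [listing]

theorem sum_listing {n : ℕ} (S : TaskSystem n) (I : Finset (Fin n)) {M : Type} [AddCommMonoid M]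
    (F : ℤ → ℤ → ℤ → M) :
    ∑ i ∈ I, F (S.c i) (S.p i) (S.J i)
      = ∑ k ∈ Finset.range I.card, F (listing I S.c k) (listing I S.p k) (listing I S.J k) := by
  rw [Finset.sum_range, ← Finset.sum_coe_sort, ← (I.orderIsoOfFin rfl).toEquiv.sum_comp]
  simp only [listing_eq]
  rfl

theorem exists_listing {n : ℕ} (I : Finset (Fin n)) {k : ℕ} (hk : k < I.card) :
    ∃ i ∈ I, ∀ f : Fin n → ℕ, listing I f (k : ℤ) = f i :=
  ⟨I.orderIsoOfFin rfl ⟨k, hk⟩, (I.orderIsoOfFin rfl ⟨k, hk⟩).2, fun f => listing_eq I f ⟨k, hk⟩⟩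

/-- Dropping the condition `0 ≤ t` does not change the least solution: with jitters `J i ≥ 0`, the
demand at a time `t ≤ 0` is at least `t` times the utilization, hence at least `t`, so that `t` is
no solution for `γ ≥ 1`. -/
theorem TaskSystem.isResponse_of_isLeast {n : ℕ} {S : TaskSystem n} {I : Finset (Fin n)} {γ t : ℤ}
    (hγ : 1 ≤ γ) (hU : S.utilization I < 1)
    (h : IsLeast {t | γ + excess (fun k : ℕ => listing I S.c k) (fun k : ℕ => listing I S.p k)
      (fun k : ℕ => listing I S.J k) I.card t ≤ 0} t) :
    S.IsResponse I γ t := by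
  have hex : ∀ s, excess (fun k : ℕ => listing I S.c k) (fun k : ℕ => listing I S.p k)
      (fun k : ℕ => listing I S.J k) I.card s
        = ∑ i ∈ I, (S.c i : ℤ) * ⌈((s : ℚ) + (S.J i : ℚ)) / (S.p i : ℚ)⌉ - s := by
    intro s
    rw [excess, ← sum_listing S I fun c p J => c * cdiv (s + J) p]
    congr 1
    refine Finset.sum_congr rfl fun i _ => ?_
    rw [cdiv_eq_ceil (by exact_mod_cast S.one_le_p i)]
    push_cast
    rfl
  have hset : {s : ℤ | 0 ≤ s ∧
      γ + ∑ i ∈ I, (S.c i : ℤ) * ⌈((s : ℚ) + (S.J i : ℚ)) / (S.p i : ℚ)⌉ ≤ s}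
      = {s | γ + excess (fun k : ℕ => listing I S.c k) (fun k : ℕ => listing I S.p k)
      (fun k : ℕ => listing I S.J k) I.card s ≤ 0} := by
    ext s
    simp only [Set.mem_ofPred_eq, hex]
    refine ⟨fun h => by linarith [h.2], fun h => ⟨?_, by linarith⟩⟩
    by_contra hs
    have hs' : (s : ℚ) < 0 := by exact_mod_cast not_le.1 hs
    have h1 : (s : ℚ) * S.utilization I
        ≤ ∑ i ∈ I, (S.c i : ℚ) * (⌈((s : ℚ) + (S.J i : ℚ)) / (S.p i : ℚ)⌉ : ℚ) := by
      rw [TaskSystem.utilization, Finset.mul_sum]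
      refine Finset.sum_le_sum fun i _ => ?_
      rw [← mul_div_assoc, mul_comm, mul_div_assoc]
      refine mul_le_mul_of_nonneg_left (le_trans ?_ (Int.le_ceil _)) (Nat.cast_nonneg _)
      have := Nat.cast_nonneg (α := ℚ) (S.J i)
      gcongr
      linarith
    have h2 : (γ : ℚ) + (∑ i ∈ I, (S.c i : ℚ) *
        (⌈((s : ℚ) + (S.J i : ℚ)) / (S.p i : ℚ)⌉ : ℚ) - s) ≤ 0 := by exact_mod_cast h
    have h3 : (1 : ℚ) ≤ γ := by exact_mod_cast hγ
    nlinarith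
  rwa [TaskSystem.IsResponse, hset]

end RTC

theorem mainTheorem1 :
    ∃ (P : RTC.Prog) (C : ℝ),
      ∀ (n : ℕ) (S : RTC.TaskSystem n) (I : Finset (Fin n)) (γ : ℤ),
        1 ≤ γ → S.Harmonic I → S.utilization I < 1 →
          ∃ (σ : RTC.State) (T : ℕ),
            RTC.Exec P (RTC.input S I γ) σ T ∧
            S.IsResponse I γ σ.output ∧
            (T : ℝ) ≤ C * ((S.numDiff I : ℝ) * (I.card : ℝ) ^ 2 +
              (I.card : ℝ) ^ 2 * Real.logb 2 (S.pmax : ℝ) + 1) := by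
  refine ⟨RTC.responseProg, 198, fun n S I γ hγ hI hU => ?_⟩
  obtain ⟨σ, T, hexec, hT, hσ⟩ := RTC.runs_responseProg (m := I.card) (γ := γ)
    (c := fun k : ℕ => RTC.listing I S.c k) (p := fun k : ℕ => RTC.listing I S.p k)
    (J := fun k : ℕ => RTC.listing I S.J k) (σ := RTC.input S I γ)
    ⟨rfl, fun _ _ => rfl, fun _ _ => rfl, fun _ _ => rfl⟩ rfl (fun _ => rfl)
    (by
      intro k hk
      obtain ⟨i, -, hi⟩ := RTC.exists_listing I hk
      simp [hi])
    (by
      intro k hk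
      obtain ⟨i, -, hi⟩ := RTC.exists_listing I hk
      rw [hi]
      exact_mod_cast S.one_le_p i)
    (by
      intro k hk l hl hkl
      obtain ⟨i, hi, hi'⟩ := RTC.exists_listing I hk
      obtain ⟨j, hj, hj'⟩ := RTC.exists_listing I hl
      rw [hi', hj'] at hkl ⊢
      exact_mod_cast hI j hj i hi (by exact_mod_cast hkl))
    (by
      rw [← RTC.sum_listing S I fun c p _ => (c : ℚ) / (p : ℚ)]
      simpa [RTC.TaskSystem.utilization] using hU)
  refine ⟨σ, T, hexec, RTC.TaskSystem.isResponse_of_isLeast hγ hU hσ, ?_⟩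
  have hT' : (T : ℝ) ≤ 198 * (I.card : ℝ) ^ 2 + 26 := by exact_mod_cast hT
  have hlog : 0 ≤ Real.logb 2 (S.pmax : ℝ) :=
    div_nonneg (Real.log_natCast_nonneg _) (Real.log_nonneg one_le_two)
  -- A nonempty `I` has at least one difference `p i - J i`, so the first term dominates `|I| ^ 2`.
  have hq : (I.card : ℝ) ^ 2 ≤ (S.numDiff I : ℝ) * (I.card : ℝ) ^ 2 := by
    rcases I.eq_empty_or_nonempty with rfl | hne
    · simp
    · have : (1 : ℝ) ≤ S.numDiff I := by
        exact_mod_cast Finset.card_pos.2 (hne.image _)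
      exact le_mul_of_one_le_left (sq_nonneg _) this
  have := mul_nonneg (sq_nonneg (I.card : ℝ)) hlog
  linarith
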